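/- Let $k$ be a field and let $H$ be a finite-dimensional Hopf algebra over $k$, with antipode $S$, counit $\epsilon$ and iterated coproduct $h\mapsto h^1\otimes h^2\otimes h^3$. **Contramodules.** For an $H$-module $M$ let $H$ act on $\mathrm{Hom}_k(H,M)$ by $(x\cdot\varphi)(h)=x^2\varphi(S(x^3)hx^1)$. An *anti-Yetter–Drinfeld (aYD) contramodule* over $H$ is an $H$-module $M$ with an $H$-linear map $\alpha\colon \mathrm{Hom}_k(H,M)\to M$ such that $\alpha(h\mapsto\epsilon(h)m)=m$ for all $m\in M$ and $\alpha(h\mapsto\alpha(F(h)))=\alpha(h\mapsto F(h^1)(h^2))$ for all $F\in\mathrm{Hom}_k(H,\mathrm{Hom}_k(H,M))$ (that is, a module over the monad $\mathrm{Hom}_k(H,-)$ on $H$-modules). Morphisms are the $H$-linear maps commuting with $\alpha$. The map $\sigma_M\colon m\mapsto\alpha(h\mapsto hm)$ is a natural endomorphism of $M$, and $M$ is *stable* if $\sigma_M=\mathrm{id}_M$. **Mixed objects.** A *mixed aYD contramodule* is a cochain complex $(M^\bullet,d)$ of aYD contramodules (with $d$ of degree $+1$) with a family $h$ of morphisms of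 aYD contramodules of degree $-1$ such that $dh+hd=\sigma-1$ and $h^2=0$. A *mixed complex of stable aYD contramodules* is a cochain complex of stable aYD contramodules with such an $h$ satisfying $dh+hd=0$ and $h^2=0$. Each kind forms a DG category: the morphisms of degree $n$ from $M$ to $N$ are the families of morphisms of aYD contramodules $f\colon M^p\to N^{p+n}$, $p\in\mathbb Z$, with $fh=(-1)^nhf$, and the differential is $f\mapsto df-(-1)^nfd$. **Twisted double.** $\widehat D(H)=\mathrm{End}_k(H)$ with product $(f\star g)(h)=f(h^1)^2\,g\big(S(f(h^1)^3)\,h^2\,f(h^1)^1\big)$, identity element $1=\epsilon(-)1$ and central element $\sigma=\mathrm{id}_H$. **Lemma.** Suppose that the linear operator $f\mapsto(\sigma-1)\star f$ on $\widehat D(H)$ is diagonalizable over $k$. Then the DG category of mixed complexes of stable aYD contramodules and the DG category of mixed aYD contramodules are DG-equivalent: there is a DG functor $F$ from the former to the latter that is a quasi-equivalence, i.e. $F$ induces isomorphisms on the cohomology of all complexes of morphisms, and every object of the target is homotopy equivalent to an object in the image of $F$. Moreover $F$ can be chosen so that the complex underlying $X$ is acyclic if and only if the complex underlying $F(X)$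 is. -/

import Mathlib

open CategoryTheory TensorProduct

universe u v w u' v'

/-! ### Contramodules and the twisted double of a Hopf algebra

Sweedler notation: `Δ h = h¹ ⊗ h²`, `Δ² h = h¹ ⊗ h² ⊗ h³`. -/

namespace AYD

noncomputable section

variable (k : Type v) (H : Type u) [Field k] [Ring H] [HopfAlgebra k H]

/-- The iterated coproduct `h ↦ h¹ ⊗ (h² ⊗ h³)`. -/
def comul₂ : H →ₗ[k] H ⊗[k] (H ⊗[k] H) :=
  (Coalgebra.comul (R := k) (A := H)).lTensor H ∘ₗ Coalgebra.comul

section Monad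

variable (M : Type w) [AddCommGroup M] [Module k M] [Module H M] [IsScalarTower k H M]

variable {k H M} in
lemma smul_smul_comm (b : H) (r : k) (m : M) : b • r • m = r • b • m :=
  (Algebra.lsmul k k M b).map_smul r m

/-- For `a, b, c : H` the operator `φ ↦ (h ↦ b φ(S(c) h a))` on `Hom_k(H, M)`. -/
def twist (a b c : H) : (H →ₗ[k] M) →ₗ[k] (H →ₗ[k] M) where
  toFun φ := Algebra.lsmul k k M b ∘ₗ φ ∘ₗ
    LinearMap.mulLeft k (HopfAlgebra.antipode k c) ∘ₗ LinearMap.mulRight k a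
  map_add' φ ψ := by ext h; simp
  map_smul' r φ := by ext h; simp [smul_smul_comm]

@[simp] lemma twist_apply (a b c h : H) (φ : H →ₗ[k] M) :
    twist k H M a b c φ h = b • φ (HopfAlgebra.antipode k c * (h * a)) := rfl

/-- The linear map `a ⊗ (b ⊗ c) ↦ (φ ↦ (h ↦ b φ(S(c) h a)))`. -/
def twistLift : H ⊗[k] (H ⊗[k] H) →ₗ[k] (H →ₗ[k] M) →ₗ[k] (H →ₗ[k] M) :=
  TensorProduct.lift
    { toFun := fun a => TensorProduct.lift
        (LinearMap.mk₂ k (fun b c => twist k H M a b c)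
          (by intros; ext; simp [add_smul]) (by intros; ext; simp)
          (by intros; ext; simp [add_mul, smul_add])
          (by intros; ext; simp [smul_smul_comm]))
      map_add' := by
        intros; ext; simp [mul_add, smul_add]
      map_smul' := by
        intros; ext; simp [smul_smul_comm] }

@[simp] lemma twistLift_tmul (a b c : H) :
    twistLift k H M (a ⊗ₜ (b ⊗ₜ c)) = twist k H M a b c := rfl

/-- The `H`-module structure of `Hom_k(H, M)`: `(x · φ)(h) = x² φ(S(x³) h x¹)`. -/
def act : H →ₗ[k] (H →ₗ[k] M) →ₗ[k] (H →ₗ[k] M) :=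
  twistLift k H M ∘ₗ comul₂ k H

variable {k H M} in
/-- The element `h ↦ ε(h) m` of `Hom_k(H, M)` (the unit of the monad `Hom_k(H, -)`). -/
def unitMap (m : M) : H →ₗ[k] M := (Coalgebra.counit (R := k) (A := H)).smulRight m

variable {k H M} in
/-- The element `h ↦ F(h¹)(h²)` of `Hom_k(H, M)` (the multiplication of the monad). -/
def contract (F : H →ₗ[k] H →ₗ[k] M) : H →ₗ[k] M :=
  TensorProduct.lift F ∘ₗ Coalgebra.comul

variable {H M} in
/-- The element `h ↦ h m` of `Hom_k(H, M)` (the central element `σ` of the monad). -/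
def sigmaMap (m : M) : H →ₗ[k] M := (Algebra.lsmul k k M).toLinearMap.flip m

variable {H M} in
@[simp] lemma sigmaMap_apply (m : M) (h : H) : sigmaMap k m h = h • m := rfl

variable {k H M} in
lemma twistLift_sigmaMap (m : M) (h : H) (t : H ⊗[k] (H ⊗[k] H)) :
    twistLift k H M t (sigmaMap k m) h =
      TensorProduct.lift (LinearMap.mk₂ k (fun a y : H => (y * (h * a)) • m)
          (by intros; simp [mul_add, add_smul]) (by intros; simp)
          (by intros; simp [add_mul, add_smul]) (by intros; simp))
        ((LinearMap.mul' k H ∘ₗ (HopfAlgebra.antipode k).lTensor H).lTensor H t) := by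
  induction t with
  | zero => simp
  | add x y hx hy => simp only [map_add, LinearMap.add_apply, hx, hy]
  | tmul a t =>
    induction t with
    | zero => simp
    | add x y hx hy => simp only [tmul_add, map_add, LinearMap.add_apply, hx, hy]
    | tmul b c => simp [mul_smul]

variable {k H M} in
/-- `x · (h ↦ h m) = (h ↦ h x m)`. -/
lemma act_sigmaMap (x : H) (m : M) : act k H M x (sigmaMap k m) = sigmaMap k (x • m) := by
  ext h
  have h1 : (LinearMap.mul' k H ∘ₗ (HopfAlgebra.antipode k).lTensor H).lTensor H (comul₂ k H x)
      = x ⊗ₜ 1 := by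
    have e : (LinearMap.mul' k H ∘ₗ (HopfAlgebra.antipode k).lTensor H) ∘ₗ Coalgebra.comul
        = Algebra.linearMap k H ∘ₗ Coalgebra.counit :=
      HopfAlgebra.mul_antipode_lTensor_comul
    rw [comul₂, ← LinearMap.comp_apply, ← LinearMap.comp_assoc, ← LinearMap.lTensor_comp, e,
      LinearMap.lTensor_comp, LinearMap.comp_apply, LinearMap.comp_apply,
      Coalgebra.lTensor_counit_comul]
    simp
  rw [act, LinearMap.comp_apply, twistLift_sigmaMap, h1]
  simp [mul_smul]

variable {k H M} in
/-- `h¹ ⊗ h² ↦ (h¹ · φ)(h²)` is `h ↦ h² φ(h¹)`. -/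
lemma contract_act (φ : H →ₗ[k] M) :
    contract ((act k H M).flip φ) = contract (LinearMap.mk₂ k (fun a b : H => b • φ a)
      (by intros; simp) (by intros; simp [smul_smul_comm]) (by intros; simp [add_smul])
      (by intros; simp)) := by
  -- the functional `a ⊗ (b ⊗ (c ⊗ e)) ↦ b φ(S(c) e a)`
  let Φ : H ⊗[k] (H ⊗[k] (H ⊗[k] H)) →ₗ[k] M :=
    TensorProduct.lift
      { toFun := fun a => TensorProduct.lift
          (LinearMap.mk₂ k (fun b s => b • φ (s * a))
            (by intros; simp [add_smul]) (by intros; simp)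
            (by intros; simp [add_mul]) (by intros; simp [smul_smul_comm])) ∘ₗ
            (LinearMap.mul' k H ∘ₗ (HopfAlgebra.antipode k).rTensor H).lTensor H
        map_add' := by intros; ext; simp [mul_add]
        map_smul' := by intros; ext; simp [smul_smul_comm] }
  have hΦ : ∀ a b c e : H,
      Φ (a ⊗ₜ (b ⊗ₜ (c ⊗ₜ e))) = b • φ (HopfAlgebra.antipode k c * e * a) := fun _ _ _ _ => rfl
  -- `h¹ ⊗ h² ⊗ h³ ⊗ h⁴`, bracketed in two ways
  have h1 : TensorProduct.lift ((act k H M).flip φ) =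
      Φ ∘ₗ ((TensorProduct.assoc k H H H).toLinearMap.lTensor H) ∘ₗ
        (TensorProduct.assoc k H (H ⊗[k] H) H).toLinearMap ∘ₗ (comul₂ k H).rTensor H := by
    ext x y
    simp only [AlgebraTensorModule.curry_apply, LinearMap.restrictScalars_self, curry_apply,
      lift.tmul, LinearMap.flip_apply, LinearMap.comp_apply, LinearMap.rTensor_tmul, act]
    induction comul₂ k H x with
    | zero => simp
    | add s t hs ht => simp only [map_add, LinearMap.add_apply, hs, ht, add_tmul]
    | tmul a t =>
      induction t with
      | zero => simp
      | add s t hs ht => simp only [map_add, tmul_add, add_tmul, LinearMap.add_apply, hs, ht]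
      | tmul b c => simp [hΦ, mul_assoc]
  have h2 : ((TensorProduct.assoc k H H H).toLinearMap.lTensor H) ∘ₗ
        (TensorProduct.assoc k H (H ⊗[k] H) H).toLinearMap ∘ₗ (comul₂ k H).rTensor H ∘ₗ
          Coalgebra.comul =
      ((Coalgebra.comul (R := k) (A := H)).lTensor H ∘ₗ Coalgebra.comul).lTensor H ∘ₗ
        Coalgebra.comul := by
    have e1 : (TensorProduct.assoc k H (H ⊗[k] H) H).toLinearMap ∘ₗ
        ((Coalgebra.comul (R := k) (A := H)).lTensor H).rTensor H =
        ((Coalgebra.comul (R := k) (A := H)).rTensor H).lTensor H ∘ₗ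
          (TensorProduct.assoc k H H H).toLinearMap := by
      ext; simp
    rw [← Coalgebra.coassoc (R := k) (A := H), comul₂, LinearMap.rTensor_comp,
      LinearMap.lTensor_comp, LinearMap.lTensor_comp, LinearMap.comp_assoc, LinearMap.comp_assoc,
      LinearMap.comp_assoc, ← Coalgebra.coassoc (R := k) (A := H)]
    rw [← LinearMap.comp_assoc (h := (TensorProduct.assoc k H (H ⊗[k] H) H).toLinearMap), e1]
    rfl
  have h3 : (LinearMap.mul' k H ∘ₗ (HopfAlgebra.antipode k).rTensor H).lTensor H ∘ₗ
      (Coalgebra.comul (R := k) (A := H)).lTensor H ∘ₗ Coalgebra.comul =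
      (TensorProduct.mk k H H).flip 1 := by
    have e : (LinearMap.mul' k H ∘ₗ (HopfAlgebra.antipode k).rTensor H) ∘ₗ Coalgebra.comul
        = Algebra.linearMap k H ∘ₗ Coalgebra.counit :=
      HopfAlgebra.mul_antipode_rTensor_comul
    ext x
    rw [← LinearMap.comp_assoc, ← LinearMap.lTensor_comp, e,
      LinearMap.lTensor_comp, LinearMap.comp_apply, LinearMap.comp_apply,
      Coalgebra.lTensor_counit_comul]
    simp
  have h4 : Φ ∘ₗ ((Coalgebra.comul (R := k) (A := H)).lTensor H ∘ₗ Coalgebra.comul).lTensor H =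
      TensorProduct.lift (LinearMap.mk₂ k (fun a b : H => b • φ a)
      (by intros; simp) (by intros; simp [smul_smul_comm]) (by intros; simp [add_smul])
      (by intros; simp)) := by
    ext a x
    have := LinearMap.congr_fun h3 x
    simp only [LinearMap.comp_apply] at this
    simp [Φ, this]
  rw [contract, h1, contract, ← h4, LinearMap.comp_assoc, LinearMap.comp_assoc,
    LinearMap.comp_assoc, LinearMap.comp_assoc, ← h2]

end Monad

/-! ### The category of anti-Yetter--Drinfeld contramodules -/

/-- An anti-Yetter--Drinfeld contramodule over `H`: an `H`-module `M` with an action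
`α : Hom_k(H, M) → M` of the monad `Hom_k(H, -)` on `H`-modules, i.e. `α` is `H`-linear for the
`H`-module structure `act` of `Hom_k(H, M)`, unital and associative. -/
structure Contramodule where
  carrier : Type w
  [addCommGroup : AddCommGroup carrier]
  [module : Module k carrier]
  [moduleH : Module H carrier]
  [isScalarTower : IsScalarTower k H carrier]
  α : (H →ₗ[k] carrier) →ₗ[k] carrier
  α_act : ∀ (x : H) (φ : H →ₗ[k] carrier), α (act k H carrier x φ) = x • α φ
  α_unit : ∀ m : carrier, α (unitMap m) = m
  α_contract : ∀ F : H →ₗ[k] H →ₗ[k] carrier, α (α ∘ₗ F) = α (contract F)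

namespace Contramodule

attribute [instance] addCommGroup module moduleH isScalarTower

instance : CoeSort (Contramodule.{u, v, w} k H) (Type w) := ⟨carrier⟩

variable {k H}

/-- Morphisms of contramodules: `H`-linear maps that commute with the actions of the monad. -/
@[ext]
structure Hom (M N : Contramodule.{u, v, w} k H) where
  toLin : M →ₗ[H] N
  map_α : ∀ φ : H →ₗ[k] M, toLin (M.α φ) = N.α (toLin.restrictScalars k ∘ₗ φ)

instance : Category (Contramodule.{u, v, w} k H) where
  Hom M N := Hom M N
  id M := ⟨LinearMap.id, fun _ => rfl⟩
  comp f g := ⟨g.toLin ∘ₗ f.toLin, fun φ => by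
    rw [LinearMap.comp_apply, f.map_α, g.map_α]; rfl⟩

@[ext]
lemma hom_ext {M N : Contramodule.{u, v, w} k H} {f g : M ⟶ N} (h : f.toLin = g.toLin) : f = g :=
  Hom.ext h

@[simp] lemma id_toLin (M : Contramodule.{u, v, w} k H) : Hom.toLin (𝟙 M) = LinearMap.id := rfl

@[simp] lemma comp_toLin {M N P : Contramodule.{u, v, w} k H} (f : M ⟶ N) (g : N ⟶ P) :
    Hom.toLin (f ≫ g) = g.toLin ∘ₗ f.toLin := rfl

variable (M N : Contramodule.{u, v, w} k H)

/-- The morphisms of contramodules as a `k`-submodule of the `H`-linear maps. -/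
def homSubmodule : Submodule k (M →ₗ[H] N) where
  carrier := {f | ∀ φ : H →ₗ[k] M, f (M.α φ) = N.α (f.restrictScalars k ∘ₗ φ)}
  zero_mem' φ := by
    simp
  add_mem' {f g} hf hg φ := by
    have : (f + g).restrictScalars k ∘ₗ φ =
      f.restrictScalars k ∘ₗ φ + g.restrictScalars k ∘ₗ φ := rfl
    rw [this, map_add, ← hf, ← hg]; rfl
  smul_mem' r f hf φ := by
    have : (r • f).restrictScalars k ∘ₗ φ = r • (f.restrictScalars k ∘ₗ φ) := rfl
    rw [this, map_smul, ← hf]; rfl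

/-- Morphisms of contramodules are the elements of `homSubmodule`. -/
def homEquiv : (M ⟶ N) ≃ homSubmodule M N where
  toFun f := ⟨f.toLin, f.map_α⟩
  invFun f := ⟨f.1, f.2⟩
  left_inv _ := rfl
  right_inv _ := rfl

instance : AddCommGroup (M ⟶ N) := (homEquiv M N).addCommGroup

instance : Module k (M ⟶ N) := (homEquiv M N).module k

variable {M N}

@[simp] lemma add_toLin (f g : M ⟶ N) : Hom.toLin (f + g) = f.toLin + g.toLin := rfl

@[simp] lemma sub_toLin (f g : M ⟶ N) : Hom.toLin (f - g) = f.toLin - g.toLin := rfl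

@[simp] lemma zero_toLin : Hom.toLin (0 : M ⟶ N) = 0 := rfl

@[simp] lemma smul_toLin (r : k) (f : M ⟶ N) : Hom.toLin (r • f) = r • f.toLin := rfl

instance : Preadditive (Contramodule.{u, v, w} k H) where
  add_comp _ _ _ f g h := by ext; simp
  comp_add _ _ _ f g h := by ext; simp

instance : Linear k (Contramodule.{u, v, w} k H) where
  smul_comp _ _ _ r f g := by
    ext x
    exact (g.toLin.restrictScalars k).map_smul r (f.toLin x)
  comp_smul _ _ _ f r g := by ext; rfl

variable (k H) in
/-- The central element `σ`: it acts on `M` by `m ↦ α(h ↦ h m)`. -/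
def sigma : CatCenter (Contramodule.{u, v, w} k H) where
  app M :=
    { toLin :=
        { toFun := fun m => M.α (sigmaMap k m)
          map_add' := fun m n => by simp [sigmaMap]
          map_smul' := fun x m => by rw [← act_sigmaMap, M.α_act]; rfl }
      map_α := fun φ => by
        have h1 : sigmaMap k (M.α φ) = M.α ∘ₗ (act k H M).flip φ := by
          ext h; simp [M.α_act]
        change M.α (sigmaMap k (M.α φ)) = M.α _
        rw [h1, M.α_contract, contract_act]
        exact (M.α_contract ((LinearMap.flip
          (Algebra.lsmul k k M.carrier : H →ₐ[k] Module.End k M.carrier).toLinearMap) ∘ₗ φ)).symm }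
  naturality M N f := by
    ext m
    have : sigmaMap (H := H) k (f.toLin m) =
        f.toLin.restrictScalars k ∘ₗ sigmaMap (H := H) k m := by
      ext h; simp
    change N.α (sigmaMap k (f.toLin m)) = f.toLin (M.α (sigmaMap k m))
    rw [f.map_α, this]

lemma sigma_apply (M : Contramodule.{u, v, w} k H) (m : M) :
    ((sigma k H).app M).toLin m = M.α (sigmaMap k m) := rfl

variable (k H) in
/-- A contramodule is stable if `σ` acts on it as the identity. -/
def IsStable : ObjectProperty (Contramodule.{u, v, w} k H) :=
  fun M => (sigma k H).app M = 𝟙 M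

end Contramodule

/-- The full subcategory of stable anti-Yetter--Drinfeld contramodules. -/
abbrev StableContramodule := (Contramodule.IsStable.{u, v, w} k H).FullSubcategory

/-! ### The twisted double -/

/-- The underlying space `End_k(H)` of the twisted double of `H`. -/
abbrev TwistedDouble := H →ₗ[k] H

namespace TwistedDouble

/-- The product of the twisted double:
`(f ⋆ g)(h) = f(h¹)² g(S(f(h¹)³) h² f(h¹)¹)`, that is `(f ⋆ g)(h) = (f(h¹) · g)(h²)` for the
action of `H` on `Hom_k(H, H)`. -/
def star (f g : TwistedDouble k H) : TwistedDouble k H :=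
  contract ((act k H H).flip g ∘ₗ f)

/-- The identity element `h ↦ ε(h) 1` of the twisted double. -/
def one : TwistedDouble k H := unitMap 1

/-- The central element `σ = id` of the twisted double. -/
def sigma : TwistedDouble k H := LinearMap.id

/-- The operator `f ↦ (σ - 1) ⋆ f` on the twisted double. -/
def sigmaSubOne : Module.End k (TwistedDouble k H) where
  toFun f := star k H (sigma k H - one k H) f
  map_add' f g := by
    ext h
    simp only [star, contract, map_add, LinearMap.comp_apply, LinearMap.add_apply,
      LinearMap.add_comp]
    induction (Coalgebra.comul (R := k) h) with
    | zero => simp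
    | add s t hs ht => simp only [map_add, hs, ht]; abel
    | tmul a b => simp
  map_smul' r f := by
    ext h
    simp only [star, contract, map_smul, LinearMap.comp_apply, LinearMap.smul_apply,
      LinearMap.smul_comp, RingHom.id_apply]
    induction (Coalgebra.comul (R := k) h) with
    | zero => simp
    | add s t hs ht => simp only [map_add, hs, ht, smul_add]
    | tmul a b => simp

end TwistedDouble

/-- A linear operator is diagonalizable if the space is spanned by its eigenvectors. -/
def IsDiagonalizable {V : Type*} [AddCommGroup V] [Module k V] (T : Module.End k V) : Prop :=
  ⨆ c : k, T.eigenspace c = ⊤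

end

end AYD

/-! ### DG categories -/

/-- A small `k`-linear DG category, with cohomological grading. Composition is written in
diagrammatic order, `comp f g = g ∘ f`, so that the Leibniz rule
`d (g ∘ f) = d g ∘ f + (-1) ^ |g| g ∘ d f` reads
`d (comp f g) = comp f (d g) + (-1) ^ |g| comp (d f) g`. -/
structure DGCat (k : Type*) [CommRing k] where
  Obj : Type u
  Hom : Obj → Obj → ℤ → Type v
  [addCommGroup : ∀ X Y n, AddCommGroup (Hom X Y n)]
  [module : ∀ X Y n, Module k (Hom X Y n)]
  d : ∀ {X Y : Obj} (n m : ℤ), n + 1 = m → (Hom X Y n →ₗ[k] Hom X Y m)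
  d_d : ∀ {X Y : Obj} (n m p : ℤ) (hm : n + 1 = m) (hp : m + 1 = p) (f : Hom X Y n),
    d m p hp (d n m hm f) = 0
  id : ∀ X : Obj, Hom X X 0
  comp : ∀ {X Y Z : Obj} {m n p : ℤ}, m + n = p → (Hom X Y m →ₗ[k] Hom Y Z n →ₗ[k] Hom X Z p)
  id_comp : ∀ {X Y : Obj} {n : ℤ} (f : Hom X Y n), comp (zero_add n) (id X) f = f
  comp_id : ∀ {X Y : Obj} {n : ℤ} (f : Hom X Y n), comp (add_zero n) f (id Y) = f
  assoc : ∀ {W X Y Z : Obj} {a b c ab bc abc : ℤ} (hab : a + b = ab) (hbc : b + c = bc)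
    (h : ab + c = abc) (h' : a + bc = abc) (f : Hom W X a) (g : Hom X Y b) (e : Hom Y Z c),
    comp h (comp hab f g) e = comp h' f (comp hbc g e)
  leibniz : ∀ {X Y Z : Obj} {m n p m' n' p' : ℤ} (hp : m + n = p) (hm' : m + 1 = m')
    (hn' : n + 1 = n') (hp' : p + 1 = p') (f : Hom X Y m) (g : Hom Y Z n),
    d p p' hp' (comp hp f g) = comp (by lia) f (d n n' hn' g) +
      n.negOnePow • comp (by lia) (d m m' hm' f) g

namespace DGCat

attribute [instance] DGCat.addCommGroup DGCat.module

variable {k : Type*} [CommRing k]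

section

variable (C : DGCat.{u, v} k) (X Y : C.Obj) (n : ℤ)

/-- Closed morphisms of degree `n`. -/
def cocycles : Submodule k (C.Hom X Y n) := LinearMap.ker (C.d n (n + 1) rfl)

/-- Exact morphisms of degree `n`. -/
def coboundaries : Submodule k (C.Hom X Y n) := LinearMap.range (C.d (n - 1) n (by lia))

/-- The cohomology `Hⁿ` of the complex of morphisms. -/
abbrev cohomology : Type _ :=
  C.cocycles X Y n ⧸ (C.coboundaries X Y n).submoduleOf (C.cocycles X Y n)

variable {X Y} in
/-- Two objects are homotopy equivalent if they are isomorphic in the category `H⁰(C)`. -/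
def HomotopyEquivalent (X Y : C.Obj) : Prop :=
  ∃ (f : C.Hom X Y 0) (g : C.Hom Y X 0), f ∈ C.cocycles X Y 0 ∧ g ∈ C.cocycles Y X 0 ∧
    C.comp (add_zero 0) f g - C.id X ∈ C.coboundaries X X 0 ∧
    C.comp (add_zero 0) g f - C.id Y ∈ C.coboundaries Y Y 0

end

end DGCat

/-- DG functors. -/
structure DGFunctor {k : Type*} [CommRing k] (C : DGCat.{u, v} k) (D : DGCat.{u', v'} k) where
  obj : C.Obj → D.Obj
  map : ∀ {X Y : C.Obj} {n : ℤ}, C.Hom X Y n →ₗ[k] D.Hom (obj X) (obj Y) n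
  map_d : ∀ {X Y : C.Obj} (n m : ℤ) (h : n + 1 = m) (f : C.Hom X Y n),
    map (C.d n m h f) = D.d n m h (map f)
  map_id : ∀ X : C.Obj, map (C.id X) = D.id (obj X)
  map_comp : ∀ {X Y Z : C.Obj} {m n p : ℤ} (h : m + n = p) (f : C.Hom X Y m) (g : C.Hom Y Z n),
    map (C.comp h f g) = D.comp h (map f) (map g)

namespace DGFunctor

variable {k : Type*} [CommRing k] {C : DGCat.{u, v} k} {D : DGCat.{u', v'} k} (F : DGFunctor C D)

/-- The map induced by a DG functor on closed morphisms. -/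
def mapCocycles (X Y : C.Obj) (n : ℤ) :
    C.cocycles X Y n →ₗ[k] D.cocycles (F.obj X) (F.obj Y) n :=
  F.map.restrict fun f hf => by
    rw [DGCat.cocycles, LinearMap.mem_ker] at hf ⊢
    rw [← F.map_d, hf, map_zero]

/-- The map induced by a DG functor on the cohomology of the complexes of morphisms. -/
def mapCohomology (X Y : C.Obj) (n : ℤ) :
    C.cohomology X Y n →ₗ[k] D.cohomology (F.obj X) (F.obj Y) n :=
  Submodule.mapQ _ _ (F.mapCocycles X Y n) fun f hf => by
    obtain ⟨g, hg⟩ := hf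
    exact ⟨F.map g, by rw [← F.map_d, hg]; rfl⟩

/-- A DG functor is a quasi-equivalence if it induces isomorphisms on the cohomology of all
complexes of morphisms, and every object of the target is homotopy equivalent to one in the
image. -/
structure IsQuasiEquivalence : Prop where
  bijective : ∀ (X Y : C.Obj) (n : ℤ), Function.Bijective (F.mapCohomology X Y n)
  essSurj : ∀ Y : D.Obj, ∃ X : C.Obj, D.HomotopyEquivalent (F.obj X) Y

end DGFunctor

/-! ### Mixed complexes -/

section

open CochainComplex.HomComplex

/-- For a preadditive category `C` with an element `z` of its centre: complexes `(K, d)` in `C`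
with a homotopy `h` of degree `-1` such that `d h + h d = z` and `h² = 0`. -/
structure MixedComplex (C : Type u) [Category.{v} C] [Preadditive C] (z : CatCenter C) where
  K : CochainComplex C ℤ
  h : Cochain K K (-1)
  δ_h : δ (-1) 0 h = Cochain.ofHoms fun p => z.app (K.X p)
  h_comp_h : h.comp h (show (-1 : ℤ) + (-1) = -2 by norm_num) = 0

namespace MixedComplex

variable (k : Type*) [CommRing k] {C : Type u} [Category.{v} C] [Preadditive C] [Linear k C]
  {z : CatCenter C}

/-- The morphisms of degree `n`: families of morphisms `f : Kᵖ → Lᵖ⁺ⁿ` in `C` such that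
`f h = (-1)ⁿ h f`. -/
def homs (X Y : MixedComplex C z) (n : ℤ) : Submodule k (Cochain X.K Y.K n) where
  carrier := {f | X.h.comp f (show -1 + n = n - 1 by lia) =
    n.negOnePow • f.comp Y.h (show n + -1 = n - 1 by lia)}
  zero_mem' := by simp
  add_mem' {f g} hf hg := by
    simp only [Set.mem_ofPred_eq] at hf hg ⊢
    rw [Cochain.comp_add, Cochain.add_comp, hf, hg, smul_add]
  smul_mem' r f hf := by
    simp only [Set.mem_ofPred_eq] at hf ⊢
    rw [Cochain.comp_smul, Cochain.smul_comp, hf, smul_comm]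

lemma mem_homs {X Y : MixedComplex C z} {n : ℤ} {f : Cochain X.K Y.K n} :
    f ∈ homs k X Y n ↔ X.h.comp f (show -1 + n = n - 1 by lia) =
      n.negOnePow • f.comp Y.h (show n + -1 = n - 1 by lia) := Iff.rfl

lemma mem_homs_iff {X Y : MixedComplex C z} {n p : ℤ} (hp : -1 + n = p) {f : Cochain X.K Y.K n} :
    f ∈ homs k X Y n ↔ X.h.comp f hp = n.negOnePow • f.comp Y.h (by lia) := by
  obtain rfl : p = n - 1 := by lia
  rfl

lemma ofHoms_comp_eq {X Y : MixedComplex C z} {n : ℤ} (f : Cochain X.K Y.K n) :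
    (Cochain.ofHoms fun p => z.app (X.K.X p)).comp f (zero_add n) =
      f.comp (Cochain.ofHoms fun p => z.app (Y.K.X p)) (add_zero n) := by
  ext p q hpq
  simp only [Cochain.zero_cochain_comp_v, Cochain.comp_zero_cochain_v, Cochain.ofHoms_v]
  exact (z.naturality _).symm

lemma δ_mem_homs {X Y : MixedComplex C z} {n m : ℤ} (hm : n + 1 = m) {f : Cochain X.K Y.K n}
    (hf : f ∈ homs k X Y n) : δ n m f ∈ homs k X Y m := by
  subst hm
  rw [mem_homs] at hf
  rw [mem_homs_iff k (show -1 + (n + 1) = n by lia)]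
  have h1 := congrArg (δ (n - 1) n) hf
  rw [δ_units_smul, δ_comp X.h f _ 0 (n + 1) n (by lia) (by lia) (by lia),
    δ_comp f Y.h _ (n + 1) 0 n (by lia) (by lia) (by lia), X.δ_h, Y.δ_h, ofHoms_comp_eq,
    smul_add, add_comm, add_right_inj, smul_smul, ← Int.negOnePow_add] at h1
  rw [h1]
  congr 1
  rw [Int.negOnePow_eq_iff]
  exact ⟨-1, by lia⟩

lemma id_mem_homs (X : MixedComplex C z) : Cochain.ofHom (𝟙 X.K) ∈ homs k X X 0 := by
  rw [mem_homs]; simp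

lemma comp_mem_homs {X Y Z : MixedComplex C z} {m n p : ℤ} (hp : m + n = p)
    {f : Cochain X.K Y.K m} {g : Cochain Y.K Z.K n} (hf : f ∈ homs k X Y m)
    (hg : g ∈ homs k Y Z n) : f.comp g hp ∈ homs k X Z p := by
  rw [mem_homs] at *
  subst hp
  rw [← Cochain.comp_assoc X.h f g (show -1 + m = m - 1 by lia) rfl (by lia), hf,
    Cochain.units_smul_comp,
    Cochain.comp_assoc f Y.h g (show m + -1 = m - 1 by lia) (show -1 + n = n - 1 by lia) (by lia),
    hg, Cochain.comp_units_smul, smul_smul, ← Int.negOnePow_add,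
    Cochain.comp_assoc f g Z.h rfl (show n + -1 = n - 1 by lia) (by lia)]

/-- The DG category of mixed complexes. The differential of a morphism `f` of degree `n` is
`d f - (-1)ⁿ f d`. -/
def dgCat (z : CatCenter C) : DGCat.{max u v, v} k where
  Obj := MixedComplex C z
  Hom X Y n := homs k X Y n
  d n m h := (δ_hom k _ _ n m).restrict fun _ hf => δ_mem_homs k h hf
  d_d n m p hm hp f := Subtype.ext (δ_δ n m p f.1)
  id X := ⟨Cochain.ofHom (𝟙 X.K), id_mem_homs k X⟩
  comp h := LinearMap.mk₂ k (fun f g => ⟨f.1.comp g.1 h, comp_mem_homs k h f.2 g.2⟩)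
    (fun _ _ _ => Subtype.ext (Cochain.add_comp _ _ _ h))
    (fun _ _ _ => Subtype.ext (Cochain.smul_comp _ _ _ h))
    (fun _ _ _ => Subtype.ext (Cochain.comp_add _ _ _ h))
    (fun _ _ _ => Subtype.ext (Cochain.comp_smul _ _ _ h))
  id_comp f := Subtype.ext (Cochain.id_comp f.1)
  comp_id f := Subtype.ext (Cochain.comp_id f.1)
  assoc hab hbc h h' f g e := Subtype.ext (Cochain.comp_assoc f.1 g.1 e.1 hab hbc (by lia))
  leibniz hp hm' hn' hp' f g := Subtype.ext (δ_comp f.1 g.1 hp _ _ _ hp' hm' hn')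

end MixedComplex

end

namespace AYD

variable (k : Type v) (H : Type u) [Field k] [Ring H] [HopfAlgebra k H]

/-- The DG category of mixed anti-Yetter--Drinfeld contramodules: complexes of contramodules
with a homotopy `h`, `d h + h d = σ - 1`. -/
noncomputable abbrev mixedContramodules : DGCat k :=
  MixedComplex.dgCat k (C := Contramodule.{u, v, w} k H) (Contramodule.sigma k H - 1)

/-- The DG category of mixed complexes of stable anti-Yetter--Drinfeld contramodules: complexes
of stable contramodules with a homotopy `h`, `d h + h d = 0`. -/
noncomputable abbrev mixedStableContramodules : DGCat k :=
  MixedComplex.dgCat k (C := StableContramodule.{u, v, w} k H) 0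

/-- A complex of contramodules is acyclic if it is exact at each place. -/
def Acyclic {k : Type v} {H : Type u} [Field k] [Ring H] [HopfAlgebra k H]
    (K : CochainComplex (Contramodule.{u, v, w} k H) ℤ) : Prop :=
  ∀ (p q r : ℤ) (_ : p + 1 = q) (_ : q + 1 = r) (x : K.X q),
    (K.d q r).toLin x = 0 → ∃ y : K.X p, (K.d p q).toLin y = x

/-- The complex of contramodules underlying a mixed contramodule. -/
abbrev underlying {k : Type v} {H : Type u} [Field k] [Ring H] [HopfAlgebra k H]
    (X : (mixedContramodules.{u, v, w} k H).Obj) : CochainComplex (Contramodule.{u, v, w} k H) ℤ :=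
  MixedComplex.K X

/-- The complex of contramodules underlying a mixed complex of stable contramodules. -/
abbrev underlyingOfStable {k : Type v} {H : Type u} [Field k] [Ring H] [HopfAlgebra k H]
    (X : (mixedStableContramodules.{u, v, w} k H).Obj) :
    CochainComplex (Contramodule.{u, v, w} k H) ℤ :=
  ((Contramodule.IsStable k H).ι.mapHomologicalComplex _).obj (MixedComplex.K X)

end AYD

/-! The functor $F$ is induced by the inclusion of stable contramodules into all contramodules. It
does not change underlying complexes, so acyclicity is preserved and reflected trivially. As the
inclusion is fully faithful and the condition $fh=\pm hf$ is tested after it, $F$ is bijective on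
complexes of morphisms, not only on their cohomology.

The content is essential surjectivity. Put $z=\sigma-1$. Diagonalizability gives $g\in\widehat D(H)$
with $z^2g=z$, and $\widehat D(H)$ acts on every contramodule by $m\mapsto\alpha(h\mapsto g(h)m)$,
naturally in $M$ (`doubleAct_star`, `map_doubleAct`). This action is a priori only $k$-linear, but
the group inverse $s=zg^2$ commutes with every map that intertwines $z$ (`groupInverse_comm`), in
particular with the action of $H$ and with $\alpha$. So $s$ lies in the centre of the category, and
$e=1-zs$ is a central idempotent with image $\ker z$, the largest stable subcontramodule.

Thus a mixed contramodule $Y$ splits as $\ker z\oplus\operatorname{im}z$, compatibly with $d$ and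
$h$. Since $dh+hd=z$ and $s$ is central, $d(sh)+(sh)d=zs=1-e$, so the second summand is contractible
and $\ker z\to Y$ is a homotopy equivalence (`homotopyEquivalent_mapObj`). -/

namespace DGFunctor

/-! ### DG functors that are bijective on morphisms -/

variable {k : Type*} [CommRing k] {C : DGCat.{u, v} k} {D : DGCat.{u', v'} k} (F : DGFunctor C D)

/-- A DG functor that is bijective on morphisms induces isomorphisms on cohomology. -/
lemma mapCohomology_bijective {X Y : C.Obj}
    (hF : ∀ n, Function.Bijective (F.map : C.Hom X Y n →ₗ[k] _)) (n : ℤ) :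
    Function.Bijective (F.mapCohomology X Y n) := by
  constructor
  · rw [injective_iff_map_eq_zero]
    intro x hx
    obtain ⟨f, rfl⟩ := Submodule.Quotient.mk_surjective _ x
    have h : Submodule.Quotient.mk (F.mapCocycles X Y n f) =
        (0 : D.cohomology (F.obj X) (F.obj Y) n) := hx
    rw [Submodule.Quotient.mk_eq_zero] at h ⊢
    -- Surjectivity in degree $n-1$ lifts the primitive; injectivity in degree $n$ shows that the
    -- lift is a primitive of `f`.
    obtain ⟨g, hg⟩ := h
    obtain ⟨g, rfl⟩ := (hF (n - 1)).2 g
    exact ⟨g, (hF n).1 ((F.map_d _ _ _ _).trans hg)⟩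
  · intro y
    obtain ⟨⟨f, hf⟩, rfl⟩ := Submodule.Quotient.mk_surjective _ y
    obtain ⟨f, rfl⟩ := (hF n).2 f
    have hf' : f ∈ C.cocycles X Y n := by
      rw [DGCat.cocycles, LinearMap.mem_ker] at hf ⊢
      -- Closedness descends along $F$ by injectivity one degree higher.
      exact (hF (n + 1)).1 (by rw [F.map_d, hf, map_zero])
    exact ⟨Submodule.Quotient.mk ⟨f, hf'⟩, rfl⟩

end DGFunctor

/-! ### Functoriality of mixed complexes and the splitting argument -/

namespace MixedComplex

open CochainComplex.HomComplex

variable {C : Type u} [Category.{v} C] [Preadditive C] {D : Type u'} [Category.{v'} D]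
  [Preadditive D] {z : CatCenter C} {z' : CatCenter D} (Φ : C ⥤ D) [Φ.Additive]

/-- The image of a mixed complex under an additive functor that is compatible with the given
central elements. -/
abbrev mapObj (hΦ : ∀ X, Φ.map (z.app X) = z'.app (Φ.obj X)) (X : MixedComplex C z) :
    MixedComplex D z' where
  K := (Φ.mapHomologicalComplex _).obj X.K
  h := X.h.map Φ
  δ_h := by
    rw [δ_map, X.δ_h]
    ext p
    simp only [Cochain.map_v, Cochain.ofHoms_v]
    exact hΦ (X.K.X p)
  h_comp_h := by rw [← Cochain.map_comp, X.h_comp_h, Cochain.map_zero]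

lemma cochain_map_units_smul {K L : CochainComplex C ℤ} {n : ℤ} (f : Cochain K L n) (a : ℤˣ) :
    (a • f).map Φ = a • f.map Φ := by
  rcases Int.units_eq_one_or a with rfl | rfl
  · rw [one_smul, one_smul]
  · simp

lemma cochain_map_injective [Φ.Faithful] {K L : CochainComplex C ℤ} {n : ℤ} :
    Function.Injective (fun f : Cochain K L n => f.map Φ) := by
  intro f g hfg
  ext p q hpq
  exact Φ.map_injective (Cochain.congr_v hfg p q hpq)

variable (k : Type*) [CommRing k] [Linear k D]

lemma map_mem_homs [Linear k C] (hΦ : ∀ X, Φ.map (z.app X) = z'.app (Φ.obj X))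
    {X Y : MixedComplex C z} {n : ℤ} {f : Cochain X.K Y.K n} (hf : f ∈ homs k X Y n) :
    f.map Φ ∈ homs k (mapObj Φ hΦ X) (mapObj Φ hΦ Y) n := by
  have h := congrArg (fun g : Cochain X.K Y.K (n - 1) => g.map Φ) ((mem_homs k).1 hf)
  rw [Cochain.map_comp, cochain_map_units_smul, Cochain.map_comp] at h
  exact h

lemma map_mem_homs_iff [Linear k C] [Φ.Faithful] (hΦ : ∀ X, Φ.map (z.app X) = z'.app (Φ.obj X))
    {X Y : MixedComplex C z} {n : ℤ} {f : Cochain X.K Y.K n} :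
    f.map Φ ∈ homs k (mapObj Φ hΦ X) (mapObj Φ hΦ Y) n ↔ f ∈ homs k X Y n := by
  refine ⟨fun hf => (mem_homs k).2 (cochain_map_injective Φ ?_), map_mem_homs Φ k hΦ⟩
  beta_reduce
  rw [Cochain.map_comp, cochain_map_units_smul, Cochain.map_comp]
  exact (mem_homs k).1 hf

/-- The map induced by a linear functor on morphisms of mixed complexes. -/
def mapHoms [Linear k C] [Φ.Linear k] (hΦ : ∀ X, Φ.map (z.app X) = z'.app (Φ.obj X))
    (X Y : MixedComplex C z) (n : ℤ) :
    homs k X Y n →ₗ[k] homs k (mapObj Φ hΦ X) (mapObj Φ hΦ Y) n where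
  toFun f := ⟨f.1.map Φ, map_mem_homs Φ k hΦ f.2⟩
  map_add' f g := Subtype.ext (Cochain.map_add f.1 g.1 Φ)
  map_smul' r f := Subtype.ext (by
    ext p q hpq
    exact Φ.map_smul r _)

lemma mapHoms_bijective [Linear k C] [Φ.Linear k] [Φ.Full] [Φ.Faithful]
    (hΦ : ∀ X, Φ.map (z.app X) = z'.app (Φ.obj X)) (X Y : MixedComplex C z) (n : ℤ) :
    Function.Bijective (mapHoms Φ k hΦ X Y n) := by
  constructor
  · intro f g hfg
    exact Subtype.ext (cochain_map_injective Φ (congrArg Subtype.val hfg))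
  · rintro ⟨f, hf⟩
    let g : Cochain X.K Y.K n := Cochain.mk fun p q hpq => Φ.preimage (f.v p q hpq)
    have hg : g.map Φ = f := by
      ext p q hpq
      exact Φ.map_preimage _
    exact ⟨⟨g, (map_mem_homs_iff Φ k hΦ).1 (hg ▸ hf)⟩, Subtype.ext hg⟩

/-- The DG functor induced by a linear functor that is compatible with the given central
elements. -/
def mapDGFunctor [Linear k C] [Φ.Linear k] (hΦ : ∀ X, Φ.map (z.app X) = z'.app (Φ.obj X)) :
    DGFunctor (dgCat k z) (dgCat k z') where
  obj := mapObj Φ hΦ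
  map {X Y n} := mapHoms Φ k hΦ X Y n
  map_d n m _ f := Subtype.ext (δ_map n m f.1 Φ).symm
  map_id _ := Subtype.ext ((Cochain.map_ofHom _ _ _ Φ).trans
    (congrArg Cochain.ofHom ((Φ.mapHomologicalComplex _).map_id _)))
  map_comp h f g := Subtype.ext (Cochain.map_comp _ f.1 g.1 h Φ)

variable {Φ}

lemma ofHom_mem_homs [Linear k C] {X Y : MixedComplex C z} (f : X.K ⟶ Y.K)
    (hf : ∀ p q (hpq : p + -1 = q), X.h.v p q hpq ≫ f.f q = f.f p ≫ Y.h.v p q hpq) :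
    Cochain.ofHom f ∈ homs k X Y 0 := by
  rw [mem_homs]
  ext p q hpq
  simpa using hf p q hpq

lemma ofHom_mem_cocycles [Linear k C] {X Y : MixedComplex C z} (f : X.K ⟶ Y.K)
    (hf : Cochain.ofHom f ∈ homs k X Y 0) :
    (⟨Cochain.ofHom f, hf⟩ : homs k X Y 0) ∈ (dgCat k z).cocycles X Y 0 :=
  Subtype.ext (δ_ofHom f)

/-- Multiplication by a central element commutes with `h`. -/
lemma smul_h_mem_homs [Linear k C] (X : MixedComplex C z) (s : CatCenter C) :
    X.h.comp (Cochain.ofHoms fun p => s.app (X.K.X p)) (add_zero (-1)) ∈ homs k X X (-1) := by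
  have h0 : (Cochain.ofHoms fun p => s.app (X.K.X p)).comp X.h (zero_add (-1)) =
      X.h.comp (Cochain.ofHoms fun p => s.app (X.K.X p)) (add_zero (-1)) := by
    ext p q hpq
    simpa using (s.naturality (X.h.v p q hpq)).symm
  -- Both sides vanish: `s` moves past $h$, and then $h^2=0$.
  rw [mem_homs]
  rw [← Cochain.comp_assoc_of_third_is_zero_cochain]
  rw [Cochain.comp_assoc_of_second_is_zero_cochain, h0,
    ← Cochain.comp_assoc_of_third_is_zero_cochain]
  rw [X.h_comp_h]
  simp

/-- `δ (s h) = z s` for a central element `s`. -/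
lemma δ_smul_h (X : MixedComplex C z) (s : CatCenter C) :
    δ (-1) 0 (X.h.comp (Cochain.ofHoms fun p => s.app (X.K.X p)) (add_zero (-1))) =
      Cochain.ofHoms fun p => (z * s).app (X.K.X p) := by
  -- A central element commutes with $d$, so it is a cocycle and only $\delta h=z$ contributes to
  -- the Leibniz rule.
  have h0 : δ 0 1 (Cochain.ofHoms fun p => s.app (X.K.X p)) = 0 := by
    ext p q hpq
    rw [δ_zero_cochain_v]
    simp only [Cochain.ofHoms_v, Cochain.zero_v, sub_eq_zero]
    exact (s.naturality (X.K.d p q)).symm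
  rw [δ_comp X.h _ (add_zero (-1)) 0 1 0 (by simp) (by simp) (by simp), h0, X.δ_h]
  ext p
  simpa using s.naturality (z.app (X.K.X p))

/-- An object `Y` with `1 - z s = i ∘ p` for a retraction `p` of `i` is homotopy equivalent to the
image of the retract. -/
lemma homotopyEquivalent_mapObj (R : D ⥤ C) [R.Additive]
    (hΦ : ∀ X, Φ.map (z.app X) = z'.app (Φ.obj X)) (hR : ∀ Y, R.map (z'.app Y) = z.app (R.obj Y))
    (i : R ⋙ Φ ⟶ 𝟭 D) (p : 𝟭 D ⟶ R ⋙ Φ) (s : CatCenter D) (hip : i ≫ p = 𝟙 _)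
    (hpi : ∀ Y, p.app Y ≫ i.app Y = 𝟙 Y - (z' * s).app Y) (Y : MixedComplex D z') :
    (dgCat k z').HomotopyEquivalent (mapObj Φ hΦ (mapObj R hR Y)) Y := by
  let X : MixedComplex D z' := mapObj Φ hΦ (mapObj R hR Y)
  let f : X.K ⟶ Y.K :=
    { f := fun n => i.app _
      comm' := fun a b _ => (i.naturality (Y.K.d a b)).symm }
  let g : Y.K ⟶ X.K :=
    { f := fun n => p.app _
      comm' := fun a b _ => (p.naturality (Y.K.d a b)).symm }
  -- The components of $h$, like those of $d$, are morphisms of `D`; naturality of `i` and `p` gives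
  -- the compatibility.
  have hf : Cochain.ofHom f ∈ homs k X Y 0 :=
    ofHom_mem_homs k f fun a b hab => i.naturality (Y.h.v a b hab)
  have hg : Cochain.ofHom g ∈ homs k Y X 0 :=
    ofHom_mem_homs k g fun a b hab => p.naturality (Y.h.v a b hab)
  refine ⟨⟨_, hf⟩, ⟨_, hg⟩, ofHom_mem_cocycles k f hf, ofHom_mem_cocycles k g hg, ?_, ?_⟩
  -- This composite is the identity strictly, so the zero homotopy suffices.
  · have h1 : (Cochain.ofHom f).comp (Cochain.ofHom g) (add_zero 0) = Cochain.ofHom (𝟙 X.K) := by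
      rw [← Cochain.ofHom_comp]
      congr 1
      ext n
      exact congrArg (fun t => t.app (Y.K.X n)) hip
    exact ⟨(0 : homs k X X (-1)), Subtype.ext ((δ_zero (-1) 0).trans (sub_eq_zero.2 h1).symm)⟩
  -- The other composite differs from the identity by $-zs$, which is the differential of $-sh$.
  · have h2 : δ (-1) 0 (-(Y.h.comp (Cochain.ofHoms fun p => s.app (Y.K.X p)) (add_zero (-1)))) =
        (Cochain.ofHom g).comp (Cochain.ofHom f) (add_zero 0) - Cochain.ofHom (𝟙 Y.K) := by
      rw [δ_neg, δ_smul_h]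
      ext n
      simp only [Cochain.neg_v, Cochain.ofHoms_v, Cochain.sub_v, Cochain.ofHom_v,
        Cochain.comp_zero_cochain_v, HomologicalComplex.id_f]
      refine Eq.trans ?_ (congrArg (· - 𝟙 (Y.K.X n)) (hpi (Y.K.X n))).symm
      abel
    exact ⟨-(⟨_, smul_h_mem_homs k Y s⟩ : homs k Y Y (-1)), Subtype.ext h2⟩

/-- A fully faithful linear functor with a retraction `R` up to the contractible part `z s` induces
a quasi-equivalence of DG categories of mixed complexes. -/
theorem mapDGFunctor_isQuasiEquivalence [Linear k C] [Φ.Linear k]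
    [Φ.Full] [Φ.Faithful] (R : D ⥤ C) [R.Additive]
    (hΦ : ∀ X, Φ.map (z.app X) = z'.app (Φ.obj X)) (hR : ∀ Y, R.map (z'.app Y) = z.app (R.obj Y))
    (i : R ⋙ Φ ⟶ 𝟭 D) (p : 𝟭 D ⟶ R ⋙ Φ) (s : CatCenter D) (hip : i ≫ p = 𝟙 _)
    (hpi : ∀ Y, p.app Y ≫ i.app Y = 𝟙 Y - (z' * s).app Y) :
    (mapDGFunctor Φ k hΦ).IsQuasiEquivalence where
  bijective X Y n :=
    (mapDGFunctor Φ k hΦ).mapCohomology_bijective (mapHoms_bijective Φ k hΦ X Y) n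
  essSurj Y :=
    ⟨mapObj R hR Y, homotopyEquivalent_mapObj k R hΦ hR i p s hip hpi Y⟩

end MixedComplex

/-! ### Naturality, group inverses and diagonalizable operators -/

namespace AYD

section

variable {k : Type v} {H : Type u} [Field k] [Ring H] [HopfAlgebra k H]

section Naturality

variable {M N : Type*} [AddCommGroup M] [Module k M] [Module H M] [IsScalarTower k H M]
  [AddCommGroup N] [Module k N] [Module H N] [IsScalarTower k H N]

lemma comp_act (f : M →ₗ[H] N) (x : H) (φ : H →ₗ[k] M) :
    f.restrictScalars k ∘ₗ act k H M x φ = act k H N x (f.restrictScalars k ∘ₗ φ) := by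
  simp only [act, LinearMap.comp_apply]
  induction comul₂ k H x with
  | zero => simp
  | add s t hs ht => simp only [map_add, LinearMap.add_apply, LinearMap.comp_add, hs, ht]
  | tmul a t =>
    induction t with
    | zero => simp
    | add s t hs ht =>
      simp only [tmul_add, map_add, LinearMap.add_apply, LinearMap.comp_add, hs, ht]
    | tmul b c => ext h; simp

omit [Module H M] [IsScalarTower k H M] [Module H N] [IsScalarTower k H N] in
lemma comp_contract (f : M →ₗ[k] N) (F : H →ₗ[k] H →ₗ[k] M) :
    f ∘ₗ contract F = contract (F.compr₂ f) := by
  rw [contract, contract, ← LinearMap.comp_assoc, TensorProduct.lift_compr₂]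

end Naturality

/-- A map that intertwines `z` and `z'` also intertwines their group inverses `z g²` and `z' g'²`,
where `z² g = z` and `z'² g' = z'`. -/
lemma groupInverse_comm {V W : Type*} {z g : V → V} {z' g' : W → W} {x : V → W}
    (hz : ∀ v, z (z (g v)) = z v)
    (hzg' : ∀ v, z' (g' v) = g' (z' v)) (hz' : ∀ v, z' (z' (g' v)) = z' v)
    (hx : ∀ v, x (z v) = z' (x v)) (v : V) : x (z (g (g v))) = z' (g' (g' (x v))) := by
  -- Here $z'g'x=g'xz=g'xz^2g=g'z'^2xg=z'xg=xzg$. No additivity enters, so `x` may be any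
  -- intertwiner between any two sets.
  have h : ∀ v, x (z (g v)) = z' (g' (x v)) := fun v => by
    rw [hzg', ← hx, ← hz v, hx, hx, hx, ← hzg', ← hzg', hz']
  rw [h, hzg', ← hx, h, hzg', hzg', hzg']

/-- For a diagonalizable operator `T` the range of `T²` is that of `T`. -/
lemma IsDiagonalizable.exists_apply_apply_eq {V : Type*} [AddCommGroup V] [Module k V]
    {T : Module.End k V} (hT : IsDiagonalizable k T) (v : V) : ∃ g, T (T g) = T v := by
  -- It is enough to check eigenvectors: $T^2(c^{-1}x)=cx=Tx$ if $c\ne0$, and $Tx=0$ if $c=0$.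
  have h : (⊤ : Submodule k V) ≤ (LinearMap.range (T ∘ₗ T)).comap T := by
    rw [← hT]
    refine iSup_le fun c x hx => ?_
    rw [Module.End.mem_eigenspace_iff] at hx
    by_cases hc : c = 0
    · exact ⟨0, by simp [hx, hc]⟩
    · exact ⟨c⁻¹ • x, by simp [hx, smul_smul, hc]⟩
  exact h (Submodule.mem_top (x := v))

namespace Contramodule

/-! ### The largest stable subcontramodule -/

noncomputable section

/-- The contramodule structure on an `H`-submodule that is stable under `α`. -/
def sub (M : Contramodule.{u, v, w} k H) (N : Submodule H M)
    (hN : ∀ φ : H →ₗ[k] N, M.α (N.subtype.restrictScalars k ∘ₗ φ) ∈ N) :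
    Contramodule.{u, v, w} k H where
  carrier := N
  α :=
    { toFun := fun φ => ⟨M.α (N.subtype.restrictScalars k ∘ₗ φ), hN φ⟩
      map_add' := fun φ ψ => Subtype.ext (by simp [LinearMap.comp_add])
      map_smul' := fun r φ => Subtype.ext (by simp [LinearMap.comp_smul]) }
  α_act x φ := Subtype.ext (by simp [comp_act, M.α_act])
  α_unit m := Subtype.ext (by
    have : N.subtype.restrictScalars k ∘ₗ unitMap (k := k) (H := H) m = unitMap (m : M) := by
      ext h; simp [unitMap]
    simp [this, M.α_unit])
  α_contract F := Subtype.ext (by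
    have h := M.α_contract (F.compr₂ (N.subtype.restrictScalars k))
    rw [← comp_contract] at h
    exact h)

/-- The inclusion of a subcontramodule. -/
def subι (M : Contramodule.{u, v, w} k H) (N : Submodule H M)
    (hN : ∀ φ : H →ₗ[k] N, M.α (N.subtype.restrictScalars k ∘ₗ φ) ∈ N) : sub M N hN ⟶ M :=
  Hom.mk (M := sub M N hN) N.subtype fun _ => rfl

variable (k H) in
/-- The central element `σ - 1`. -/
abbrev sigmaSubOne : CatCenter (Contramodule.{u, v, w} k H) := sigma k H - 1

/-- The operator `σ - 1` on a contramodule. -/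
abbrev sigmaSubOneLin (M : Contramodule.{u, v, w} k H) : M →ₗ[H] M :=
  ((sigmaSubOne k H).app M).toLin

lemma sigmaSubOneLin_apply (M : Contramodule.{u, v, w} k H) (m : M) :
    M.sigmaSubOneLin m = M.α (sigmaMap k m) - m := rfl

lemma map_sigmaSubOneLin {M N : Contramodule.{u, v, w} k H} (f : M ⟶ N) (m : M) :
    f.toLin (M.sigmaSubOneLin m) = N.sigmaSubOneLin (f.toLin m) :=
  (LinearMap.congr_fun (congrArg Hom.toLin ((sigmaSubOne k H).naturality f)) m).symm

/-- The largest stable subcontramodule, the kernel of `σ - 1`. -/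
def stableSub (M : Contramodule.{u, v, w} k H) : Contramodule.{u, v, w} k H :=
  sub M (LinearMap.ker M.sigmaSubOneLin) fun φ => by
    rw [LinearMap.mem_ker]
    -- Since $\sigma-1$ is itself a morphism, it passes through $\alpha$ and leaves $\alpha(0)$.
    refine (((sigmaSubOne k H).app M).map_α _).trans ?_
    convert map_zero M.α
    ext h
    exact (φ h).2

/-- The inclusion of the largest stable subcontramodule. -/
def stableSubι (M : Contramodule.{u, v, w} k H) : M.stableSub ⟶ M := subι M _ _

lemma stableSubι_injective (M : Contramodule.{u, v, w} k H) :
    Function.Injective M.stableSubι.toLin := Subtype.val_injective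

lemma isStable_iff (M : Contramodule.{u, v, w} k H) :
    IsStable k H M ↔ ∀ m : M, M.sigmaSubOneLin m = 0 := by
  refine ⟨fun h m => ?_, fun h => ?_⟩
  · rw [sigmaSubOneLin_apply, sub_eq_zero]
    exact LinearMap.congr_fun (congrArg Hom.toLin h) m
  · refine hom_ext (LinearMap.ext fun m => ?_)
    exact sub_eq_zero.1 (h m)

lemma isStable_stableSub (M : Contramodule.{u, v, w} k H) : IsStable k H M.stableSub := by
  rw [isStable_iff]
  intro m
  apply M.stableSubι_injective
  rw [map_sigmaSubOneLin, map_zero]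
  exact m.2

/-- Lift a morphism that is killed by `σ - 1` to the largest stable subcontramodule. -/
def stableSubLift {M N : Contramodule.{u, v, w} k H} (f : M ⟶ N)
    (hf : ∀ m, N.sigmaSubOneLin (f.toLin m) = 0) : M ⟶ N.stableSub :=
  Hom.mk (N := N.stableSub) (LinearMap.codRestrict _ f.toLin hf) fun φ =>
    Subtype.ext (f.map_α φ)

lemma sigmaSubOneLin_stableSubι (M : Contramodule.{u, v, w} k H) (m : M.stableSub) :
    M.sigmaSubOneLin (M.stableSubι.toLin m) = 0 := m.2

/-- The functor that sends a contramodule to its largest stable subcontramodule. -/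
def stablePart : Contramodule.{u, v, w} k H ⥤ StableContramodule.{u, v, w} k H where
  obj M := ⟨M.stableSub, M.isStable_stableSub⟩
  map {M N} f := ObjectProperty.homMk (stableSubLift (M.stableSubι ≫ f) fun m => by
    rw [comp_toLin, LinearMap.comp_apply, ← map_sigmaSubOneLin, sigmaSubOneLin_stableSubι,
      map_zero])
  map_id _ := rfl
  map_comp _ _ := rfl

instance : (stablePart (k := k) (H := H)).Additive where
  map_add {_ _ _ _} := rfl

variable (k H) in
/-- The inclusion of the largest stable subcontramodule as a natural transformation. -/
def stablePartι : stablePart ⋙ (IsStable k H).ι ⟶ 𝟭 (Contramodule.{u, v, w} k H) where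
  app M := M.stableSubι

/-! ### Contramodules as modules over the twisted double -/

/-- The action of an element of the twisted double on a contramodule: `m ↦ α(h ↦ f(h) m)`. -/
def doubleAct (M : Contramodule.{u, v, w} k H) (f : TwistedDouble k H) : M →ₗ[k] M where
  toFun m := M.α (sigmaMap k m ∘ₗ f)
  map_add' m n := by simp [sigmaMap, LinearMap.add_comp]
  map_smul' r m := by simp [sigmaMap, LinearMap.smul_comp]

lemma doubleAct_apply (M : Contramodule.{u, v, w} k H) (f : TwistedDouble k H) (m : M) :
    M.doubleAct f m = M.α (sigmaMap k m ∘ₗ f) := rfl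

lemma doubleAct_one (M : Contramodule.{u, v, w} k H) (m : M) :
    M.doubleAct (TwistedDouble.one k H) m = m := by
  have : sigmaMap k m ∘ₗ TwistedDouble.one k H = unitMap m := by
    ext h; simp [TwistedDouble.one, unitMap]
  rw [doubleAct_apply, this, M.α_unit]

/-- By $H$-linearity of $\alpha$, $f(h)\,\alpha(g(-)m)=\alpha(f(h)\cdot(g(-)m))$; associativity of
$\alpha$ then merges the two applications of $\alpha$ into the product $\star$. -/
lemma doubleAct_star (M : Contramodule.{u, v, w} k H) (f g : TwistedDouble k H) (m : M) :
    M.doubleAct (TwistedDouble.star k H f g) m = M.doubleAct f (M.doubleAct g m) := by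
  have e : sigmaMap k (M.α (sigmaMap k m ∘ₗ g)) ∘ₗ f =
      M.α ∘ₗ ((act k H M).flip (sigmaMap k m ∘ₗ g) ∘ₗ f) := by
    ext h; simp [M.α_act]
  rw [doubleAct_apply, doubleAct_apply, doubleAct_apply, e, M.α_contract, TwistedDouble.star,
    comp_contract]
  congr 2
  ext x h
  -- The $H$-linear map $x\mapsto xm$ carries the action on $\mathrm{Hom}_k(H,H)$ to that on
  -- $\mathrm{Hom}_k(H,M)$.
  exact LinearMap.congr_fun (comp_act (LinearMap.toSpanSingleton H M m) (f x) g) h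

lemma doubleAct_sigmaSubOne (M : Contramodule.{u, v, w} k H) (f : TwistedDouble k H) (m : M) :
    M.doubleAct (TwistedDouble.sigmaSubOne k H f) m = M.sigmaSubOneLin (M.doubleAct f m) := by
  refine (M.doubleAct_star _ f m).trans ?_
  have h : ∀ m : M, M.doubleAct (TwistedDouble.sigma k H - TwistedDouble.one k H) m =
      M.α (sigmaMap k m) - M.doubleAct (TwistedDouble.one k H) m := fun m => by
    rw [doubleAct_apply, LinearMap.comp_sub, map_sub]
    rfl
  rw [h, doubleAct_one, sigmaSubOneLin_apply]

lemma map_doubleAct {M N : Contramodule.{u, v, w} k H} (f : M ⟶ N) (g : TwistedDouble k H)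
    (m : M) : f.toLin (M.doubleAct g m) = N.doubleAct g (f.toLin m) := by
  have : sigmaMap k (f.toLin m) ∘ₗ g = f.toLin.restrictScalars k ∘ₗ sigmaMap k m ∘ₗ g := by
    ext h; simp
  rw [doubleAct_apply, doubleAct_apply, f.map_α, this]

/-- Naturality of the action, applied to the morphism $\sigma-1\colon M\to M$. -/
lemma sigmaSubOneLin_doubleAct (M : Contramodule.{u, v, w} k H) (g : TwistedDouble k H) (m : M) :
    M.sigmaSubOneLin (M.doubleAct g m) = M.doubleAct g (M.sigmaSubOneLin m) :=
  map_doubleAct ((sigmaSubOne k H).app M) g m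

/-! ### The group inverse of $\sigma-1$ and the stable idempotent -/

section GroupInverse

variable (g : TwistedDouble k H) (hg : ∀ (M : Contramodule.{u, v, w} k H) (m : M),
  M.sigmaSubOneLin (M.sigmaSubOneLin (M.doubleAct g m)) = M.sigmaSubOneLin m)

/-- The group inverse of the central element `σ - 1`, given an element `g` of the twisted double
with `(σ - 1)² g = σ - 1`. -/
def groupInverse : CatCenter (Contramodule.{u, v, w} k H) where
  app M :=
    { toLin :=
        { toFun := fun m => M.sigmaSubOneLin (M.doubleAct g (M.doubleAct g m))
          map_add' := fun m n => by simp only [map_add]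
          -- The action of `g` need not commute with $H$, but $zg^2$ does, because $z$ does.
          map_smul' := fun x m =>
            (groupInverse_comm (x := fun m : M => x • m) (hg M) (M.sigmaSubOneLin_doubleAct g) (hg M)
              (fun m => (M.sigmaSubOneLin.map_smul x m).symm) m).symm }
      -- The same argument with the intertwiner $\alpha$; on $\mathrm{Hom}_k(H,M)$ both operators
      -- act by postcomposition.
      map_α := fun φ => (groupInverse_comm
        (z := fun φ : H →ₗ[k] M => M.sigmaSubOneLin.restrictScalars k ∘ₗ φ)
        (g := fun φ : H →ₗ[k] M => M.doubleAct g ∘ₗ φ)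
        (fun φ => by ext h; exact hg M _)
        (M.sigmaSubOneLin_doubleAct g) (hg M)
        (fun φ => (((sigmaSubOne k H).app M).map_α φ).symm) φ).symm }
  naturality M N f := hom_ext (LinearMap.ext fun m => by
    change N.sigmaSubOneLin (N.doubleAct g (N.doubleAct g (f.toLin m))) =
      f.toLin (M.sigmaSubOneLin (M.doubleAct g (M.doubleAct g m)))
    rw [map_sigmaSubOneLin f, map_doubleAct f, map_doubleAct f])

lemma groupInverse_apply (M : Contramodule.{u, v, w} k H) (m : M) :
    ((groupInverse g hg).app M).toLin m = M.sigmaSubOneLin (M.doubleAct g (M.doubleAct g m)) := rfl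

/-- The idempotent of the centre that projects to the largest stable subcontramodules. -/
def stableIdempotent : CatCenter (Contramodule.{u, v, w} k H) :=
  1 - sigmaSubOne k H * groupInverse g hg

lemma stableIdempotent_apply (M : Contramodule.{u, v, w} k H) (m : M) :
    ((stableIdempotent g hg).app M).toLin m =
      m - M.sigmaSubOneLin (((groupInverse g hg).app M).toLin m) := by
  rw [stableIdempotent, CatCenter.app_sub, CatCenter.mul_app']
  rfl

/-- $z(1-zs)=z-z^3g^2=z-z^2g=0$. -/
lemma sigmaSubOneLin_stableIdempotent (M : Contramodule.{u, v, w} k H) (m : M) :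
    M.sigmaSubOneLin (((stableIdempotent g hg).app M).toLin m) = 0 := by
  rw [stableIdempotent_apply, map_sub, groupInverse_apply, hg, hg, sub_self]

/-- $zs=z^2g^2=zg=gz$, which kills $\ker z$. -/
lemma stableIdempotent_eq_self (M : Contramodule.{u, v, w} k H) {m : M}
    (hm : M.sigmaSubOneLin m = 0) : ((stableIdempotent g hg).app M).toLin m = m := by
  rw [stableIdempotent_apply, groupInverse_apply, hg, sigmaSubOneLin_doubleAct, hm]
  simp only [map_zero, sub_zero]

/-- The projection to the largest stable subcontramodule along the range of `σ - 1`. -/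
def stablePartπ : 𝟭 (Contramodule.{u, v, w} k H) ⟶ stablePart ⋙ (IsStable k H).ι where
  app M := stableSubLift ((stableIdempotent g hg).app M) (M.sigmaSubOneLin_stableIdempotent g hg)
  naturality M N f := by
    apply hom_ext
    ext m
    exact N.stableSubι_injective
      (LinearMap.congr_fun (congrArg Hom.toLin ((stableIdempotent g hg).naturality f)) m)

lemma stablePartι_π : stablePartι k H ≫ stablePartπ g hg = 𝟙 _ := by
  refine NatTrans.ext (funext fun M => hom_ext (LinearMap.ext fun m => ?_))
  exact M.stableSubι_injective (M.stableIdempotent_eq_self g hg m.2)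

lemma stablePartπ_ι (M : Contramodule.{u, v, w} k H) :
    (stablePartπ g hg).app M ≫ (stablePartι k H).app M =
      𝟙 M - (sigmaSubOne k H * groupInverse g hg).app M := rfl

end GroupInverse

end

end Contramodule

end

end AYD

/-- If `σ - 1` acts diagonalizably on the twisted double of the finite-dimensional Hopf algebra
`H`, then there is a quasi-equivalence from the DG category of mixed complexes of stable
anti-Yetter--Drinfeld contramodules to the DG category of mixed anti-Yetter--Drinfeld
contramodules, which moreover preserves and reflects acyclicity. -/
theorem lemma2p4 {k : Type v} {H : Type u} [Field k] [Ring H] [HopfAlgebra k H]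
    [FiniteDimensional k H]
    (hdiag : AYD.IsDiagonalizable k (AYD.TwistedDouble.sigmaSubOne k H)) :
    ∃ F : DGFunctor (AYD.mixedStableContramodules.{u, v, w} k H)
        (AYD.mixedContramodules.{u, v, w} k H),
      F.IsQuasiEquivalence ∧
        ∀ X, AYD.Acyclic (AYD.underlyingOfStable X) ↔ AYD.Acyclic (AYD.underlying (F.obj X)) := by
  -- Applied to the identity element, this says $(\sigma-1)\star(\sigma-1)\star g=\sigma-1$; the
  -- action transports the equation to every contramodule.
  obtain ⟨g, h⟩ := hdiag.exists_apply_apply_eq (AYD.TwistedDouble.one k H)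
  have hg : ∀ (M : AYD.Contramodule.{u, v, w} k H) (m : M),
      M.sigmaSubOneLin (M.sigmaSubOneLin (M.doubleAct g m)) = M.sigmaSubOneLin m := fun M m => by
    rw [← M.doubleAct_sigmaSubOne, ← M.doubleAct_sigmaSubOne, h, M.doubleAct_sigmaSubOne,
      M.doubleAct_one]
  have hι : ∀ X : AYD.StableContramodule.{u, v, w} k H,
      (AYD.Contramodule.IsStable k H).ι.map ((0 : CatCenter _).app X) =
        (AYD.Contramodule.sigma k H - 1 : CatCenter _).app
          ((AYD.Contramodule.IsStable k H).ι.obj X) := fun X => by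
    rw [CatCenter.app_sub]
    exact (sub_eq_zero.2 X.property).symm
  refine ⟨MixedComplex.mapDGFunctor _ k hι, ?_, fun _ => Iff.rfl⟩
  refine MixedComplex.mapDGFunctor_isQuasiEquivalence k AYD.Contramodule.stablePart hι
    (fun M => ?_) (AYD.Contramodule.stablePartι k H) (AYD.Contramodule.stablePartπ g hg)
    (AYD.Contramodule.groupInverse g hg) (AYD.Contramodule.stablePartι_π g hg)
    (AYD.Contramodule.stablePartπ_ι g hg)
  -- It remains that $\sigma-1$ restricts to zero on the stable part, which is its kernel.
  apply ObjectProperty.hom_ext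
  apply AYD.Contramodule.hom_ext
  ext m
  exact M.stableSubι_injective m.2
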